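/- All graphs are finite, simple and undirected. For a graph $G$ and a nonempty set $S\subseteq V(G)$, put $P^{[0]}(S)=S$, $P^{[1]}(S)=N[S]$ (the closed neighborhood of $S$), and, for $i\ge 1$, let $P^{[i+1]}(S)$ be the union of $P^{[i]}(S)$ with the set of all $w\in V(G)\setminus P^{[i]}(S)$ for which there is a $u\in P^{[i]}(S)$ with $N_G(u)\setminus P^{[i]}(S)=\{w\}$. Let $\operatorname{pt}_{\rm pd}(G;S)$ be the least positive integer $t$ with $P^{[t]}(S)=V(G)$, or $\infty$ if there is no such $t$. The product power throttling number of $G$ is \[\operatorname{th}_{\rm pd}^{\times}(G)=\min_{\emptyset\ne S\subseteq V(G)}|S|\operatorname{pt}_{\rm pd}(G;S),\] and the domination number $\gamma(G)$ is the minimum cardinality of a set $S\subseteq V(G)$ with $N[S]=V(G)$. Let $P_k$ and $C_k$ denote the path and the cycle on $k$ vertices, and let $\square$ denote the Cartesian product of graphs. Corollary. For all integers $n,m\ge 1$, \[\operatorname{th}_{\rm pd}^{\times}(J_n\square J_m)=\gamma(J_n\square J_m),\] where each of the two factors is, independently of the other, either a path or a cycle: $J_k=P_k$ or $J_k=C_k$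 if $k\ge 3$, and $J_k=P_k$ if $k\in\{1,2\}$. -/

import Mathlib

open SimpleGraph

/-- The closed neighborhood `N[S]` of a set `S` of vertices of `G`. -/
def closedNbhd {V : Type*} (G : SimpleGraph V) (S : Set V) : Set V :=
  S ∪ {w | ∃ u ∈ S, G.Adj u w}

/-- `S` dominates `G` if `N[S] = V(G)`. -/
def IsDominatingSet {V : Type*} (G : SimpleGraph V) (S : Set V) : Prop :=
  closedNbhd G S = Set.univ

/-- The domination number `γ(G)` of a finite graph: the minimum cardinality of a dominating set
(the set of such cardinalities is nonempty, because the set of all vertices dominates `G`). -/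
noncomputable def dominationNumber {V : Type*} [Fintype V] (G : SimpleGraph V) : ℕ :=
  sInf {k : ℕ | ∃ S : Finset V, IsDominatingSet G (S : Set V) ∧ S.card = k}

/-- The vertices that the observed set `B` forces in one round: the unobserved `w` such that `w`
is the only unobserved neighbor of some observed `u`. -/
def zeroForced {V : Type*} (G : SimpleGraph V) (B : Set V) : Set V :=
  {w | w ∉ B ∧ ∃ u ∈ B, G.neighborSet u \ B = {w}}

/-- The set `P^[i](S)` of vertices observed after round `i` of power domination from `S`:
`P^[0](S) = S`, `P^[1](S) = N[S]` (domination step), and afterwards one simultaneous round of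
zero forcing at a time. -/
def observedSet {V : Type*} (G : SimpleGraph V) (S : Set V) : ℕ → Set V
  | 0 => S
  | 1 => closedNbhd G S
  | (i + 2) => observedSet G S (i + 1) ∪ zeroForced G (observedSet G S (i + 1))

/-- The power propagation time `pt_pd(G; S)`: the least positive integer `t` with
`P^[t](S) = V(G)`, and `∞` if there is none (that is, if `S` is not a power dominating set). -/
noncomputable def powerPropagationTime {V : Type*} (G : SimpleGraph V) (S : Set V) : ℕ∞ :=
  ⨅ (t : ℕ) (_ : 1 ≤ t ∧ observedSet G S t = Set.univ), (t : ℕ∞)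

/-- The product power throttling number `th_pd^×(G)` of a finite graph: the minimum of
`|S| * pt_pd(G; S)` over the nonempty sets `S` of vertices. -/
noncomputable def productPowerThrottling {V : Type*} [Fintype V] (G : SimpleGraph V) : ℕ∞ :=
  ⨅ (S : Finset V) (_ : S.Nonempty), (S.card : ℕ∞) * powerPropagationTime G (S : Set V)

/-- `J` is the path `P_k`, or it is the cycle `C_k` and `k ≥ 3`. -/
def IsPathOrCycle (k : ℕ) (J : SimpleGraph (Fin k)) : Prop :=
  J = pathGraph k ∨ (3 ≤ k ∧ J = cycleGraph k)

/-!
Dominating sets have propagation time one, so the throttling number is at most the domination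
number `γ`. The claim is that a set `S` with propagation time `t ≥ 2` has `γ ≤ |S| t`. Both sides
are compared with a quarter of the number of vertices.

Lower bound. Let both factors, on `n` and `m` vertices, have maximum degree two. Forcing chains
start in `N[S] \ S`, which has at most `4|S|` vertices, so each round after the second observes at
most `4|S|` new vertices. Two rounds observe at most `8|S|` vertices
(`ncard_observedSet_two_le`): a vertex of `S` has at most three neighbors that are private to it
and force in the second round, because two forcers on perpendicular sides compete for the corner
between them (`private_neighbors_le_three`). Hence `nm ≤ 4t|S|`. If equality holds, every vertex
of `S` has exactly three such neighbors, and this fixes `S` nearby (`IsPivot`): `S` contains a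
zigzag that alternates between two adjacent lines and advances by two vertices at each step. Such a
zigzag runs off the end of a path, and closes up on a cycle only if its length is a multiple of
four (`four_dvd_of_isPivot`).

Upper bound. A cycle of length divisible by four times a path is dominated by a quarter of its
vertices (`dominationNumber_le_of_cycleGraph`), which settles the case of equality. Otherwise
`⌊nm / 4⌋ + 1 ≤ |S| t`, and `γ ≤ ⌊nm / 4⌋ + 1` for all grids with `n, m ≥ 2` (`gridDominated`), hence
for the cylinders and tori that contain them as spanning subgraphs. If a factor is a single vertex,
the product has maximum degree two, and `γ ≤ ⌈m / 3⌉` is compared with `m ≤ (2t + 1)|S|`.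
-/

/-! ### Forcing chains -/

/-- The vertices of `B` that have a neighbor outside `B`. -/
def activeSet {V : Type*} (G : SimpleGraph V) (B : Set V) : Set V :=
  {u | u ∈ B ∧ ∃ w, w ∉ B ∧ G.Adj u w}

theorem exists_forcer {V : Type*} (G : SimpleGraph V) (B : Set V) :
    ∃ φ : V → V, ∀ w ∈ zeroForced G B, φ w ∈ B ∧ G.neighborSet (φ w) \ B = {w} := by
  classical
  have h : ∀ w, ∃ u, w ∈ zeroForced G B → u ∈ B ∧ G.neighborSet u \ B = {w} := by
    intro w
    by_cases hw : w ∈ zeroForced G B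
    · obtain ⟨-, u, hu, he⟩ := hw
      exact ⟨u, fun _ => ⟨hu, he⟩⟩
    · exact ⟨w, fun h => absurd h hw⟩
  choose φ hφ using h
  exact ⟨φ, hφ⟩

/-- The vertices forced in one round have pairwise distinct forcers. -/
theorem forcer_injOn {V : Type*} {G : SimpleGraph V} {B : Set V} {φ : V → V}
    (hφ : ∀ w ∈ zeroForced G B, φ w ∈ B ∧ G.neighborSet (φ w) \ B = {w}) :
    Set.InjOn φ (zeroForced G B) := by
  intro w hw w' hw' h
  have h1 := (hφ w hw).2
  rw [h, (hφ w' hw').2] at h1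
  exact (Set.singleton_injective h1).symm

theorem forcer_mem_activeSet {V : Type*} {G : SimpleGraph V} {B : Set V} {u w : V}
    (hu : u ∈ B) (h : G.neighborSet u \ B = {w}) : u ∈ activeSet G B := by
  have hw : w ∈ G.neighborSet u \ B := h ▸ Set.mem_singleton w
  exact ⟨hu, w, hw.2, hw.1⟩

theorem ncard_zeroForced_le {V : Type*} [Finite V] (G : SimpleGraph V) (B : Set V) :
    (zeroForced G B).ncard ≤ (activeSet G B).ncard := by
  obtain ⟨φ, hφ⟩ := exists_forcer G B
  exact Set.ncard_le_ncard_of_injOn φ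
    (fun w hw => forcer_mem_activeSet (hφ w hw).1 (hφ w hw).2) (forcer_injOn hφ)

/-- A round of forcing does not increase the number of active vertices: every forcer becomes
inactive, and each newly observed vertex can be charged to its forcer. -/
theorem ncard_activeSet_union_zeroForced_le {V : Type*} [Finite V] (G : SimpleGraph V)
    (B : Set V) : (activeSet G (B ∪ zeroForced G B)).ncard ≤ (activeSet G B).ncard := by
  obtain ⟨φ, hφ⟩ := exists_forcer G B
  have hsub : activeSet G (B ∪ zeroForced G B) ⊆
      (activeSet G B \ φ '' zeroForced G B) ∪ zeroForced G B := by
    rintro u ⟨hu, w, hw, huw⟩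
    rcases hu with hu | hu
    · left
      refine ⟨⟨hu, w, fun h => hw (Or.inl h), huw⟩, ?_⟩
      rintro ⟨z, hz, rfl⟩
      have hwz : w ∈ G.neighborSet (φ z) \ B := ⟨huw, fun h => hw (Or.inl h)⟩
      rw [(hφ z hz).2] at hwz
      rw [Set.mem_singleton_iff] at hwz
      exact hw (Or.inr (hwz ▸ hz))
    · exact Or.inr hu
  have hsub' : φ '' zeroForced G B ⊆ activeSet G B := by
    rintro _ ⟨z, hz, rfl⟩
    exact forcer_mem_activeSet (hφ z hz).1 (hφ z hz).2
  have h1 := Set.ncard_le_ncard hsub (Set.toFinite _)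
  have h2 := Set.ncard_union_le (activeSet G B \ φ '' zeroForced G B) (zeroForced G B)
  have h3 := Set.ncard_sdiff_add_ncard_of_subset hsub' (Set.toFinite _)
  have h4 := (forcer_injOn hφ).ncard_image
  omega

theorem ncard_activeSet_observedSet_le {V : Type*} [Finite V] (G : SimpleGraph V) (S : Set V)
    (i : ℕ) : (activeSet G (observedSet G S (i + 1))).ncard
      ≤ (activeSet G (closedNbhd G S)).ncard := by
  induction i with
  | zero => exact le_rfl
  | succ i ih => exact (ncard_activeSet_union_zeroForced_le G _).trans ih

theorem ncard_observedSet_add_le {V : Type*} [Finite V] (G : SimpleGraph V) (S : Set V)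
    (i j : ℕ) : (observedSet G S (i + 1 + j)).ncard
      ≤ (observedSet G S (i + 1)).ncard + j * (activeSet G (closedNbhd G S)).ncard := by
  induction j with
  | zero => simp
  | succ j ih =>
    have h : observedSet G S (i + 1 + (j + 1)) = observedSet G S (i + 1 + j) ∪
        zeroForced G (observedSet G S (i + 1 + j)) := by
      rw [show i + 1 + (j + 1) = (i + j) + 2 by ring, show i + 1 + j = (i + j) + 1 by ring]
      rfl
    have h1 := Set.ncard_union_le (observedSet G S (i + 1 + j))
      (zeroForced G (observedSet G S (i + 1 + j)))
    have h2 := ncard_zeroForced_le G (observedSet G S (i + 1 + j))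
    have h3 := ncard_activeSet_observedSet_le G S (i + j)
    rw [show i + j + 1 = i + 1 + j by ring] at h3
    rw [h, add_mul]
    omega

theorem activeSet_closedNbhd_subset {V : Type*} (G : SimpleGraph V) (S : Set V) :
    activeSet G (closedNbhd G S) ⊆ closedNbhd G S \ S := by
  rintro u ⟨hu, w, hw, huw⟩
  exact ⟨hu, fun hS => hw (Or.inr ⟨u, hS, huw⟩)⟩

/-! ### The local shape around a vertex with three private forcers -/

/-- No vertex of `J` has three distinct neighbors: the maximum degree is at most two. -/
def MaxDegreeLeTwo {α : Type*} (J : SimpleGraph α) : Prop :=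
  ∀ a b c d, J.Adj a b → J.Adj a c → J.Adj a d → b = c ∨ b = d ∨ c = d

/-- `F` is a set of vertices outside `S`, each of which has exactly one neighbor outside `N[S]`,
these neighbors being pairwise distinct. A set of forcers, one for each vertex forced in the round
after the domination step, has these properties. -/
structure IsForcerSet {V : Type*} (G : SimpleGraph V) (S F : Set V) : Prop where
  notMem : ∀ u ∈ F, u ∉ S
  exists_unobserved : ∀ u ∈ F, ∃ w, w ∉ closedNbhd G S ∧ G.Adj u w
  unobserved_unique : ∀ u ∈ F, ∀ w w', w ∉ closedNbhd G S → w' ∉ closedNbhd G S →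
    G.Adj u w → G.Adj u w' → w = w'
  forcer_unique : ∀ u ∈ F, ∀ u' ∈ F, ∀ w, w ∉ closedNbhd G S → G.Adj u w → G.Adj u' w → u = u'

/-- The vertices of `F` that have at most one neighbor in `S`. -/
def privatePart {V : Type*} (G : SimpleGraph V) (S F : Set V) : Set V :=
  {u | u ∈ F ∧ ∀ s ∈ S, ∀ s' ∈ S, G.Adj u s → G.Adj u s' → s = s'}

/-- The shape of `S` around a vertex `(x, y) ∈ S` all but one of whose four neighbors force
privately in the round after the domination step. In the direction of `x'` the forcing goes
straight on; across, it turns away from `x'`; and the vertices of `S` two steps across from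
`(x', y)` keep it from doing otherwise. -/
structure IsPivot {α β : Type*} (J : SimpleGraph α) (K : SimpleGraph β) (S : Set (α × β))
    (x : α) (y : β) (x' : α) : Prop where
  adj : J.Adj x x'
  mem : (x, y) ∈ S
  notMem : (x', y) ∉ S
  exists_two : ∃ y₁ y₂, y₁ ≠ y₂ ∧ K.Adj y y₁ ∧ K.Adj y y₂
  ahead : ∃ x₂, J.Adj x' x₂ ∧ x₂ ≠ x ∧ (x₂, y) ∉ closedNbhd (J □ K) S
  behind : ∀ x₀, J.Adj x x₀ → x₀ ≠ x' → ∀ y₁, K.Adj y y₁ → (x₀, y₁) ∉ closedNbhd (J □ K) S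
  beside : ∀ y₁, K.Adj y y₁ → ∃ y₂, K.Adj y₁ y₂ ∧ y₂ ≠ y ∧ (x', y₂) ∈ S

theorem mem_closedNbhd_of_mem {V : Type*} {G : SimpleGraph V} {S : Set V} {v : V} (h : v ∈ S) :
    v ∈ closedNbhd G S := Or.inl h

theorem mem_closedNbhd_of_adj {V : Type*} {G : SimpleGraph V} {S : Set V} {u v : V} (h : u ∈ S)
    (ha : G.Adj u v) : v ∈ closedNbhd G S := Or.inr ⟨u, h, ha⟩

section LocalShape

variable {α β : Type*} {J : SimpleGraph α} {K : SimpleGraph β} {S F : Set (α × β)}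

/-- One half of the local shape: what the private forcers `(x', y)` and `(x, y₁)` around
`(x, y) ∈ S` say about the corner `(x', y₁)` between them. -/
theorem exists_mem_beside (hJ : MaxDegreeLeTwo J) (hF : IsForcerSet (J □ K) S F)
    {x x' x₂ : α} {y y₁ : β} (hxy : (x, y) ∈ S) (hx' : J.Adj x x') (hy₁ : K.Adj y y₁)
    (h0 : (x', y) ∈ privatePart (J □ K) S F) (h1 : (x, y₁) ∈ privatePart (J □ K) S F)
    (hx₂ : J.Adj x' x₂) (hne : x₂ ≠ x) (hout : (x₂, y) ∉ closedNbhd (J □ K) S) :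
    ∃ y₂, K.Adj y₁ y₂ ∧ y₂ ≠ y ∧ (x', y₂) ∈ S := by
  -- A corner that is not observed would be the target of both forcers.
  have hobs : (x', y₁) ∈ closedNbhd (J □ K) S := by
    by_contra hc
    have := hF.forcer_unique _ h0.1 _ h1.1 _ hc (by simp [boxProd_adj, hy₁])
      (by simp [boxProd_adj, hx'])
    simp only [Prod.mk.injEq] at this
    exact hx'.ne this.1.symm
  -- Its dominator is neither the corner itself, nor a forcer, nor next to `(x₂, y)`.
  rcases hobs with hS | ⟨⟨p, q⟩, hS, hadj⟩
  · have := h0.2 _ hxy _ hS (by simp [boxProd_adj, hx'.symm]) (by simp [boxProd_adj, hy₁])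
    simp only [Prod.mk.injEq] at this
    exact absurd this.1 hx'.ne
  · simp only [boxProd_adj] at hadj
    rcases hadj with ⟨hp, rfl⟩ | ⟨hq, rfl⟩
    · exfalso
      rcases hJ x' x x₂ p hx'.symm hx₂ hp.symm with h | h | h
      · exact hne h.symm
      · subst h; exact hF.notMem _ h1.1 hS
      · subst h
        exact hout (mem_closedNbhd_of_adj hS (by simp [boxProd_adj, hy₁.symm]))
    · refine ⟨q, hq.symm, ?_, hS⟩
      rintro rfl
      exact hF.notMem _ h0.1 hS

theorem IsPivot.of_private (hJ : MaxDegreeLeTwo J) (hK : MaxDegreeLeTwo K)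
    (hF : IsForcerSet (J □ K) S F) {x x' : α} {y y₁ y₂ : β} (hxy : (x, y) ∈ S)
    (hx' : J.Adj x x') (hy₁ : K.Adj y y₁) (hy₂ : K.Adj y y₂) (hy : y₁ ≠ y₂)
    (h0 : (x', y) ∈ privatePart (J □ K) S F) (h1 : (x, y₁) ∈ privatePart (J □ K) S F)
    (h2 : (x, y₂) ∈ privatePart (J □ K) S F) : IsPivot J K S x y x' := by
  have hy12 : ∀ z, K.Adj y z → (x, z) ∈ privatePart (J □ K) S F := by
    intro z hz
    rcases hK y y₁ y₂ z hy₁ hy₂ hz with h | h | h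
    · exact absurd h hy
    · exact h ▸ h1
    · exact h ▸ h2
  have hahead : ∃ x₂, J.Adj x' x₂ ∧ x₂ ≠ x ∧ (x₂, y) ∉ closedNbhd (J □ K) S := by
    obtain ⟨⟨p, q⟩, hw, hadj⟩ := hF.exists_unobserved _ h0.1
    simp only [boxProd_adj] at hadj
    rcases hadj with ⟨hp, rfl⟩ | ⟨hq, rfl⟩
    · exact ⟨p, hp, fun h => hw (mem_closedNbhd_of_mem (h ▸ hxy)), hw⟩
    · exfalso
      have := hF.forcer_unique _ h0.1 _ (hy12 q hq).1 _ hw (by simp [boxProd_adj, hq])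
        (by simp [boxProd_adj, hx'])
      simp only [Prod.mk.injEq] at this
      exact hx'.ne this.1.symm
  have hbeside : ∀ z, K.Adj y z → ∃ z₂, K.Adj z z₂ ∧ z₂ ≠ y ∧ (x', z₂) ∈ S := by
    intro z hz
    obtain ⟨x₂, hx₂, hne, hout⟩ := hahead
    exact exists_mem_beside hJ hF hxy hx' hz h0 (hy12 z hz) hx₂ hne hout
  refine ⟨hx', hxy, hF.notMem _ h0.1, ⟨y₁, y₂, hy, hy₁, hy₂⟩, hahead, ?_, hbeside⟩
  intro x₀ hx₀ hne z hz
  obtain ⟨⟨p, q⟩, hw, hadj⟩ := hF.exists_unobserved _ (hy12 z hz).1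
  obtain ⟨z₂, hz₂, hz₂y, hz₂S⟩ := hbeside z hz
  simp only [boxProd_adj] at hadj
  rcases hadj with ⟨hp, rfl⟩ | ⟨hq, rfl⟩
  · rcases hJ x x' x₀ p hx' hx₀ hp with h | h | h
    · exact absurd h.symm hne
    · subst h
      exfalso
      have := hF.forcer_unique _ h0.1 _ (hy12 z hz).1 _ hw (by simp [boxProd_adj, hz])
        (by simp [boxProd_adj, hx'])
      simp only [Prod.mk.injEq] at this
      exact hx'.ne this.1.symm
    · exact h ▸ hw
  · exfalso
    rcases hK z y z₂ q hz.symm hz₂ hq with h | h | h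
    · exact hz₂y h.symm
    · exact hw (mem_closedNbhd_of_mem (h ▸ hxy))
    · exact hw (mem_closedNbhd_of_adj hz₂S (by simp [boxProd_adj, h, hx'.symm]))

theorem IsPivot.eq_of_forcer (hF : IsForcerSet (J □ K) S F) {x x' x₀ : α} {y : β}
    (h : IsPivot J K S x y x') (hx₀ : J.Adj x x₀) (hf : (x₀, y) ∈ F) : x₀ = x' := by
  by_contra hne
  obtain ⟨y₁, y₂, hy, hy₁, hy₂⟩ := h.exists_two
  have := hF.unobserved_unique _ hf _ _ (h.behind x₀ hx₀ hne y₁ hy₁)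
    (h.behind x₀ hx₀ hne y₂ hy₂) (by simp [boxProd_adj, hy₁]) (by simp [boxProd_adj, hy₂])
  simp only [Prod.mk.injEq] at this
  exact hy this.2

end LocalShape

section Swap

variable {α β : Type*} (J : SimpleGraph α) (K : SimpleGraph β) (S : Set (α × β))

theorem closedNbhd_swap :
    closedNbhd (K □ J) (Prod.swap ⁻¹' S) = Prod.swap ⁻¹' closedNbhd (J □ K) S := by
  ext ⟨b, a⟩
  simp only [closedNbhd, Set.mem_union, Set.mem_preimage, Prod.swap_prod_mk, Set.mem_ofPred_eq,
    Prod.exists, boxProd_adj]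
  refine or_congr Iff.rfl ⟨?_, ?_⟩
  · rintro ⟨p, q, h, h'⟩; exact ⟨q, p, h, h'.symm⟩
  · rintro ⟨p, q, h, h'⟩; exact ⟨q, p, h, h'.symm⟩

variable {J K S}

theorem IsForcerSet.swap {F : Set (α × β)} (hF : IsForcerSet (J □ K) S F) :
    IsForcerSet (K □ J) (Prod.swap ⁻¹' S) (Prod.swap ⁻¹' F) := by
  have hadj : ∀ p q : β × α, (K □ J).Adj p q ↔ (J □ K).Adj p.swap q.swap := by
    intro p q
    simp [boxProd_adj, or_comm]
  constructor
  · intro u hu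
    exact hF.notMem _ hu
  · intro u hu
    obtain ⟨w, hw, h⟩ := hF.exists_unobserved _ hu
    refine ⟨w.swap, ?_, ?_⟩
    · rw [closedNbhd_swap]; simpa using hw
    · rw [hadj]; simpa using h
  · intro u hu w w' hw hw' h h'
    rw [closedNbhd_swap] at hw hw'
    rw [hadj] at h h'
    exact Prod.swap_injective (hF.unobserved_unique _ hu _ _ hw hw' h h')
  · intro u hu u' hu' w hw h h'
    rw [closedNbhd_swap] at hw
    rw [hadj] at h h'
    exact Prod.swap_injective (hF.forcer_unique _ hu _ hu' _ hw h h')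

theorem mem_privatePart_swap {F : Set (α × β)} {a : α} {b : β}
    (h : (a, b) ∈ privatePart (J □ K) S F) :
    (b, a) ∈ privatePart (K □ J) (Prod.swap ⁻¹' S) (Prod.swap ⁻¹' F) := by
  refine ⟨h.1, ?_⟩
  rintro ⟨p, q⟩ hs ⟨p', q'⟩ hs' ha ha'
  have := h.2 (q, p) hs (q', p') hs' (by simpa [boxProd_adj, or_comm] using ha)
    (by simpa [boxProd_adj, or_comm] using ha')
  simp only [Prod.mk.injEq] at this ⊢
  exact ⟨this.2, this.1⟩

end Swap

/-- Around a vertex of `S`, three private forcers fix the local shape, and a fourth is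
impossible. -/
theorem private_neighbors_le_three {α β : Type*} {J : SimpleGraph α} {K : SimpleGraph β}
    (hJ : MaxDegreeLeTwo J) (hK : MaxDegreeLeTwo K) {S F : Set (α × β)}
    (hF : IsForcerSet (J □ K) S F) {x : α} {y : β} (hxy : (x, y) ∈ S) [Finite α] [Finite β] :
    let P := {u | u ∈ privatePart (J □ K) S F ∧ (J □ K).Adj (x, y) u}
    P.ncard ≤ 3 ∧ (P.ncard = 3 → (∃ x', IsPivot J K S x y x') ∨
      ∃ y', IsPivot K J (Prod.swap ⁻¹' S) y x y') := by
  intro P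
  have key : ∀ a b c, a ∈ P → b ∈ P → c ∈ P → a ≠ b → a ≠ c → b ≠ c →
      (∃ x', IsPivot J K S x y x') ∨ ∃ y', IsPivot K J (Prod.swap ⁻¹' S) y x y' := by
    have h1 : ∀ x' y₁ y₂, (x', y) ∈ P → (x, y₁) ∈ P → (x, y₂) ∈ P → y₁ ≠ y₂ → J.Adj x x' →
        K.Adj y y₁ → K.Adj y y₂ → (∃ x', IsPivot J K S x y x') := by
      intro x' y₁ y₂ h0 h1 h2 hne hx hy hy'
      exact ⟨x', IsPivot.of_private hJ hK hF hxy hx hy hy' hne h0.1 h1.1 h2.1⟩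
    have h2 : ∀ x₁ x₂ y', (x, y') ∈ P → (x₁, y) ∈ P → (x₂, y) ∈ P → x₁ ≠ x₂ → K.Adj y y' →
        J.Adj x x₁ → J.Adj x x₂ → (∃ y', IsPivot K J (Prod.swap ⁻¹' S) y x y') := by
      intro x₁ x₂ y' h0 h1 h2 hne hx hy hy'
      exact ⟨y', IsPivot.of_private hK hJ hF.swap hxy hx hy hy' hne (mem_privatePart_swap h0.1)
        (mem_privatePart_swap h1.1) (mem_privatePart_swap h2.1)⟩
    rintro ⟨a, a'⟩ ⟨b, b'⟩ ⟨c, c'⟩ ha hb hc hab hac hbc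
    have ha2 := ha.2
    have hb2 := hb.2
    have hc2 := hc.2
    simp only [boxProd_adj] at ha2 hb2 hc2
    simp only [ne_eq, Prod.mk.injEq, not_and] at hab hac hbc
    have hJx := hJ x
    have hKy := hK y
    rcases ha2 with ⟨ha2, rfl⟩ | ⟨ha2, rfl⟩ <;> rcases hb2 with ⟨hb2, rfl⟩ | ⟨hb2, rfl⟩ <;>
      rcases hc2 with ⟨hc2, rfl⟩ | ⟨hc2, rfl⟩ <;> grind
  have hfourth : ∀ a b c d, a ∈ P → b ∈ P → c ∈ P → d ∈ P → a ≠ b → a ≠ c → a ≠ d → b ≠ c →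
      b ≠ d → c ≠ d → False := by
    rintro ⟨a, a'⟩ ⟨b, b'⟩ ⟨c, c'⟩ ⟨d, d'⟩ ha hb hc hd hab hac had hbc hbd hcd
    have hJx : ∀ x', IsPivot J K S x y x' → ∀ x₀ y₀, (x₀, y₀) ∈ P → J.Adj x x₀ → y = y₀ →
        x₀ = x' := by
      rintro x' hp x₀ _ hP hx rfl
      exact hp.eq_of_forcer hF hx hP.1.1
    have hKy : ∀ y', IsPivot K J (Prod.swap ⁻¹' S) y x y' → ∀ x₀ y₀, (x₀, y₀) ∈ P →
        K.Adj y y₀ → x = x₀ → y₀ = y' := by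
      rintro y' hp _ y₀ hP hy rfl
      exact hp.eq_of_forcer hF.swap hy hP.1.1
    have hk := key _ _ _ ha hb hc hab hac hbc
    have hJ2 := hJ x
    have hK2 := hK y
    have ha2 := ha.2
    have hb2 := hb.2
    have hc2 := hc.2
    have hd2 := hd.2
    simp only [boxProd_adj] at ha2 hb2 hc2 hd2
    simp only [ne_eq, Prod.mk.injEq, not_and] at hab hac hbc had hbd hcd
    rcases hk with ⟨z, hz⟩ | ⟨z, hz⟩
    · have hz' := hJx z hz
      clear hJx hKy
      rcases ha2 with ⟨ha2, rfl⟩ | ⟨ha2, rfl⟩ <;> rcases hb2 with ⟨hb2, rfl⟩ | ⟨hb2, rfl⟩ <;>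
        rcases hc2 with ⟨hc2, rfl⟩ | ⟨hc2, rfl⟩ <;> rcases hd2 with ⟨hd2, rfl⟩ | ⟨hd2, rfl⟩ <;>
        grind
    · have hz' := hKy z hz
      clear hJx hKy
      rcases ha2 with ⟨ha2, rfl⟩ | ⟨ha2, rfl⟩ <;> rcases hb2 with ⟨hb2, rfl⟩ | ⟨hb2, rfl⟩ <;>
        rcases hc2 with ⟨hc2, rfl⟩ | ⟨hc2, rfl⟩ <;> rcases hd2 with ⟨hd2, rfl⟩ | ⟨hd2, rfl⟩ <;>
        grind
  constructor
  · by_contra hlt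
    obtain ⟨Q, hQ, hQc⟩ := Set.exists_subset_card_eq (s := P) (n := 4) (by omega)
    obtain ⟨a, b, c, d, hab, hac, had, hbc, hbd, hcd, rfl⟩ := Set.ncard_eq_four.mp hQc
    exact hfourth a b c d (hQ (by simp)) (hQ (by simp)) (hQ (by simp)) (hQ (by simp))
      hab hac had hbc hbd hcd
  · intro h3
    obtain ⟨a, b, c, hab, hac, hbc, hP⟩ := Set.ncard_eq_three.mp h3
    exact key a b c (hP ▸ by simp) (hP ▸ by simp) (hP ▸ by simp) hab hac hbc

/-! ### Counting the vertices observed in two rounds -/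

theorem MaxDegreeLeTwo.ncard_neighborSet_le {α : Type*} [Finite α] {J : SimpleGraph α}
    (hJ : MaxDegreeLeTwo J) (a : α) : (J.neighborSet a).ncard ≤ 2 := by
  by_contra h
  obtain ⟨b, hb, c, hc, d, hd, hbc, hbd, hcd⟩ := (Set.two_lt_ncard_iff).mp (not_le.mp h)
  all_goals grind [MaxDegreeLeTwo, mem_neighborSet]

theorem ncard_neighborSet_boxProd_le {α β : Type*} [Finite α] [Finite β] {J : SimpleGraph α}
    {K : SimpleGraph β} {a b : ℕ} {s : α × β} (hJ : (J.neighborSet s.1).ncard ≤ a)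
    (hK : (K.neighborSet s.2).ncard ≤ b) : ((J □ K).neighborSet s).ncard ≤ a + b := by
  rw [neighborSet_boxProd]
  refine (Set.ncard_union_le _ _).trans (add_le_add ?_ ?_)
  · rwa [Set.ncard_prod, Set.ncard_singleton, mul_one]
  · rwa [Set.ncard_prod, Set.ncard_singleton, one_mul]

/-- Counts the edges between `S` and `A`: the vertices of `A` have a neighbor in `S`, those of `T`
have two, and no vertex of `S` has more than `d` neighbors in `A`. -/
theorem card_add_card_le_mul {V : Type*} [Fintype V] [DecidableEq V] (G : SimpleGraph V)
    [DecidableRel G.Adj] (S A T : Finset V) (d : ℕ) (hTA : T ⊆ A)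
    (hd : ∀ s ∈ S, (A.filter (G.Adj s)).card ≤ d) (hA : ∀ u ∈ A, ∃ s ∈ S, G.Adj s u)
    (hT : ∀ u ∈ T, ∃ s ∈ S, ∃ s' ∈ S, s ≠ s' ∧ G.Adj s u ∧ G.Adj s' u) :
    A.card + T.card ≤ S.card * d := by
  calc A.card + T.card = ∑ u ∈ A, (1 + if u ∈ T then 1 else 0) := by
        rw [Finset.sum_add_distrib, Finset.sum_ite_mem, Finset.inter_eq_right.mpr hTA]
        simp
    _ ≤ ∑ u ∈ A, (S.filter (fun s => G.Adj s u)).card := by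
        refine Finset.sum_le_sum fun u hu => ?_
        split_ifs with h
        · obtain ⟨s, hs, s', hs', hne, ha, ha'⟩ := hT u h
          exact Finset.one_lt_card.mpr ⟨s, by simp [hs, ha], s', by simp [hs', ha'], hne⟩
        · obtain ⟨s, hs, ha⟩ := hA u hu
          exact Finset.card_pos.mpr ⟨s, by simp [hs, ha]⟩
    _ = ∑ s ∈ S, (A.filter (G.Adj s)).card :=
        (Finset.sum_card_bipartiteAbove_eq_sum_card_bipartiteBelow (fun s u => G.Adj s u)).symm
    _ ≤ S.card * d := by
        simpa using Finset.sum_le_card_nsmul S _ d hd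

theorem ncard_closedNbhd_sdiff_le {V : Type*} [Fintype V] (G : SimpleGraph V) (S : Finset V)
    (d : ℕ) (hd : ∀ s ∈ S, (G.neighborSet s).ncard ≤ d) :
    (closedNbhd G (S : Set V) \ S).ncard ≤ S.card * d := by
  classical
  have h := card_add_card_le_mul G S (closedNbhd G (S : Set V) \ S).toFinset ∅ d (by simp)
    (fun s hs => ?_) ?_ (by simp)
  · rwa [Finset.card_empty, add_zero, ← Set.ncard_eq_toFinset_card'] at h
  · refine le_trans ?_ (hd s hs)
    rw [← Set.ncard_coe_finset]
    exact Set.ncard_le_ncard (fun u hu => by simpa using (Finset.mem_filter.mp hu).2)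
      (Set.toFinite _)
  · intro u hu
    rw [Set.mem_toFinset] at hu
    rcases hu.1 with h | ⟨s, hs, h⟩
    · exact absurd h hu.2
    · exact ⟨s, hs, h⟩

theorem ncard_closedNbhd {V : Type*} [Finite V] (G : SimpleGraph V) (S : Set V) :
    (closedNbhd G S).ncard = S.ncard + (closedNbhd G S \ S).ncard := by
  rw [add_comm]
  exact (Set.ncard_sdiff_add_ncard_of_subset (fun _ h => mem_closedNbhd_of_mem h)
    (Set.toFinite _)).symm

theorem ncard_observedSet_two {V : Type*} [Finite V] (G : SimpleGraph V) (S : Set V) :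
    (observedSet G S 2).ncard = (closedNbhd G S).ncard + (zeroForced G (closedNbhd G S)).ncard := by
  refine Set.ncard_union_eq ?_ (Set.toFinite _) (Set.toFinite _)
  exact Set.disjoint_left.mpr fun w hw hz => hz.1 hw

theorem exists_isForcerSet {V : Type*} [Finite V] (G : SimpleGraph V) (S : Set V) :
    ∃ F, IsForcerSet G S F ∧ F ⊆ closedNbhd G S \ S ∧
      F.ncard = (zeroForced G (closedNbhd G S)).ncard := by
  obtain ⟨φ, hφ⟩ := exists_forcer G (closedNbhd G S)
  have huniq : ∀ z ∈ zeroForced G (closedNbhd G S), ∀ w, w ∉ closedNbhd G S → G.Adj (φ z) w →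
      w = z := by
    intro z hz w hw ha
    have : w ∈ G.neighborSet (φ z) \ closedNbhd G S := ⟨ha, hw⟩
    rwa [(hφ z hz).2] at this
  have hsub : φ '' zeroForced G (closedNbhd G S) ⊆ closedNbhd G S \ S := by
    rintro _ ⟨z, hz, rfl⟩
    exact activeSet_closedNbhd_subset G S (forcer_mem_activeSet (hφ z hz).1 (hφ z hz).2)
  refine ⟨φ '' zeroForced G (closedNbhd G S), ⟨fun u hu => (hsub hu).2, ?_, ?_, ?_⟩, hsub,
    (forcer_injOn hφ).ncard_image⟩
  · rintro _ ⟨z, hz, rfl⟩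
    have : z ∈ G.neighborSet (φ z) \ closedNbhd G S := (hφ z hz).2 ▸ Set.mem_singleton z
    exact ⟨z, this.2, this.1⟩
  · rintro _ ⟨z, hz, rfl⟩ w w' hw hw' h h'
    rw [huniq z hz w hw h, huniq z hz w' hw' h']
  · rintro _ ⟨z, hz, rfl⟩ _ ⟨z', hz', rfl⟩ w hw h h'
    rw [← huniq z hz w hw h, ← huniq z' hz' w hw h']

/-- Two rounds observe at most eight vertices for each vertex of `S`: besides the vertex itself,
four neighbors and three vertices forced by private forcers, while a forcer with two neighbors in
`S` is paid for by its being a neighbor twice. -/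
theorem ncard_observedSet_two_le {α β : Type*} [Fintype α] [Fintype β] {J : SimpleGraph α}
    {K : SimpleGraph β} (hJ : MaxDegreeLeTwo J) (hK : MaxDegreeLeTwo K) (S : Finset (α × β)) :
    (observedSet (J □ K) S 2).ncard ≤ 8 * S.card ∧
    ((observedSet (J □ K) S 2).ncard = 8 * S.card → ∀ x y, (x, y) ∈ S →
      (∃ x', IsPivot J K (S : Set (α × β)) x y x') ∨
      ∃ y', IsPivot K J (Prod.swap ⁻¹' (S : Set (α × β))) y x y') := by
  classical
  set G := J □ K with hG
  obtain ⟨F, hF, hFsub, hFc⟩ := exists_isForcerSet G (S : Set (α × β))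
  have hloc := fun (x : α) (y : β) (h : (x, y) ∈ (S : Set (α × β))) =>
    private_neighbors_le_three hJ hK hF h
  set A := (closedNbhd G (S : Set (α × β)) \ S).toFinset with hA
  set H := (privatePart G S F).toFinset with hH
  have hHF : H ⊆ F.toFinset := by
    intro u hu
    rw [hH, Set.mem_toFinset] at hu
    simpa using hu.1
  have hFA : F.toFinset ⊆ A := by
    intro u hu
    rw [Set.mem_toFinset] at hu
    simpa [hA] using hFsub hu
  have hdom : ∀ u ∈ A, ∃ s ∈ S, G.Adj s u := by
    intro u hu
    rw [hA, Set.mem_toFinset] at hu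
    rcases hu.1 with h | ⟨s, hs, h⟩
    · exact absurd h hu.2
    · exact ⟨s, hs, h⟩
  have h1 : A.card + (F.toFinset \ H).card ≤ S.card * 4 := by
    refine card_add_card_le_mul G S A _ 4 (Finset.sdiff_subset.trans hFA) ?_ hdom ?_
    · intro s _
      refine le_trans ?_ (ncard_neighborSet_boxProd_le (hJ.ncard_neighborSet_le s.1)
        (hK.ncard_neighborSet_le s.2))
      rw [← Set.ncard_coe_finset]
      exact Set.ncard_le_ncard (fun u hu => (Finset.mem_filter.mp (Finset.mem_coe.mp hu)).2)
        (Set.toFinite _)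
    · intro u hu
      rw [Finset.mem_sdiff, Set.mem_toFinset, hH, Set.mem_toFinset] at hu
      by_contra hcon
      refine hu.2 ⟨hu.1, fun s hs s' hs' ha ha' => ?_⟩
      by_contra hne
      exact hcon ⟨s, hs, s', hs', hne, ha.symm, ha'.symm⟩
  have hk : ∀ s : α × β, (H.filter (G.Adj s)).card =
      {u | u ∈ privatePart G S F ∧ G.Adj s u}.ncard := by
    intro s
    rw [← Set.ncard_coe_finset]
    congr 1
    ext u
    simp [hH]
  have h2 : H.card ≤ ∑ s ∈ S, (H.filter (G.Adj s)).card := by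
    rw [Finset.card_eq_sum_ones]
    calc ∑ u ∈ H, 1 ≤ ∑ u ∈ H, (S.filter (fun s => G.Adj s u)).card := by
          refine Finset.sum_le_sum fun u hu => ?_
          obtain ⟨s, hs, ha⟩ := hdom u (hFA (hHF hu))
          exact Finset.card_pos.mpr ⟨s, by simp [hs, ha]⟩
      _ = _ := (Finset.sum_card_bipartiteAbove_eq_sum_card_bipartiteBelow
          (fun s u => G.Adj s u)).symm
  have h3 : ∀ s ∈ S, (H.filter (G.Adj s)).card ≤ 3 := by
    rintro ⟨x, y⟩ hs
    rw [hk]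
    exact (hloc x y hs).1
  have h4 : ∑ s ∈ S, (H.filter (G.Adj s)).card ≤ S.card * 3 := by
    simpa using Finset.sum_le_card_nsmul S _ 3 h3
  have h5 := Finset.card_sdiff_add_card_eq_card hHF
  have h6 := ncard_closedNbhd G (S : Set (α × β))
  have h7 := ncard_observedSet_two G (S : Set (α × β))
  rw [Set.ncard_coe_finset, Set.ncard_eq_toFinset_card' (closedNbhd G (S : Set (α × β)) \ S)] at h6
  rw [← hFc, Set.ncard_eq_toFinset_card' F] at h7
  rw [← hA] at h6
  refine ⟨by omega, fun heq x y hxy => ?_⟩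
  have h8 : (H.filter (G.Adj (x, y))).card = 3 := by
    refine le_antisymm (h3 _ hxy) (not_lt.mp fun hlt => ?_)
    have : ∑ s ∈ S, (H.filter (G.Adj s)).card < ∑ s ∈ S, 3 :=
      Finset.sum_lt_sum h3 ⟨_, hxy, hlt⟩
    rw [Finset.sum_const, smul_eq_mul] at this
    omega
  rw [hk] at h8
  exact (hloc x y hxy).2 h8

/-- If every vertex of `S` is a pivot, then a pivot at `(x, y)` facing `x'` comes with a pivot two
steps across and one step ahead, facing back. -/
theorem IsPivot.exists_next {α β : Type*} {J : SimpleGraph α} {K : SimpleGraph β}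
    (hK : MaxDegreeLeTwo K) {S : Set (α × β)}
    (hall : ∀ x y, (x, y) ∈ S → (∃ x', IsPivot J K S x y x') ∨
      ∃ y', IsPivot K J (Prod.swap ⁻¹' S) y x y')
    {x x' : α} {y y₁ : β} (h : IsPivot J K S x y x') (hy : K.Adj y y₁) :
    ∃ y₂, K.Adj y₁ y₂ ∧ y₂ ≠ y ∧ IsPivot J K S x' y₂ x := by
  obtain ⟨y₂, hy₂, hne, hmem⟩ := h.beside y₁ hy
  refine ⟨y₂, hy₂, hne, ?_⟩
  have hobs : (x, y₁) ∈ closedNbhd (J □ K) S :=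
    mem_closedNbhd_of_adj h.mem (by simp [boxProd_adj, hy])
  have hobs' : (x', y) ∈ closedNbhd (J □ K) S :=
    mem_closedNbhd_of_adj h.mem (by simp [boxProd_adj, h.adj])
  rcases hall _ _ hmem with ⟨x₃, h₃⟩ | ⟨y₃, h₃⟩
  · by_cases hx : x = x₃
    · exact hx ▸ h₃
    · exact absurd hobs (h₃.behind x h.adj.symm hx y₁ hy₂.symm)
  · exfalso
    by_cases hy₃ : y₁ = y₃
    · obtain ⟨z, hz, hzne, hout⟩ := h₃.ahead
      rw [← hy₃] at hz
      rw [closedNbhd_swap] at hout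
      rcases hK y₁ y y₂ z hy.symm hy₂ hz with h' | h' | h'
      · exact hne h'.symm
      · exact hout (h' ▸ hobs')
      · exact hzne h'.symm
    · have := h₃.behind y₁ hy₂.symm hy₃ x h.adj.symm
      rw [closedNbhd_swap] at this
      exact this hobs

/-! ### Pivots on paths and cycles -/

theorem cycleGraph_adj_iff_val {n : ℕ} (hn : 3 ≤ n) (u v : Fin n) :
    (cycleGraph n).Adj u v ↔ v.val = u.val + 1 ∨ u.val = v.val + 1 ∨
      (u.val = 0 ∧ v.val + 1 = n) ∨ (v.val = 0 ∧ u.val + 1 = n) := by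
  have hu := u.isLt
  have hv := v.isLt
  have key : ∀ a b : Fin n, (a - b).val = if b.val ≤ a.val then a.val - b.val
      else n - b.val + a.val := by
    intro a b
    have ha := a.isLt
    have hb := b.isLt
    rw [Fin.val_sub]
    split_ifs with h
    · rw [show n - b.val + a.val = (a.val - b.val) + n by omega, Nat.add_mod_right,
        Nat.mod_eq_of_lt (by omega)]
    · exact Nat.mod_eq_of_lt (by omega)
  rw [cycleGraph_adj', key, key]
  split_ifs <;> omega

theorem IsPathOrCycle.maxDegreeLeTwo {n : ℕ} {J : SimpleGraph (Fin n)} (h : IsPathOrCycle n J) :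
    MaxDegreeLeTwo J := by
  intro a b c d hb hc hd
  rw [Fin.ext_iff, Fin.ext_iff, Fin.ext_iff]
  rcases h with rfl | ⟨hn, rfl⟩
  · rw [pathGraph_adj] at hb hc hd
    omega
  · rw [cycleGraph_adj_iff_val hn] at hb hc hd
    omega

section Rigidity

variable {α : Type*} {J : SimpleGraph α} {n : ℕ}

/-- On a path the chain of pivots would run off the end. -/
theorem not_isPivot_pathGraph {S : Set (α × Fin n)} (hK : MaxDegreeLeTwo (pathGraph n))
    (hall : ∀ x y, (x, y) ∈ S → (∃ x', IsPivot J (pathGraph n) S x y x') ∨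
      ∃ y', IsPivot (pathGraph n) J (Prod.swap ⁻¹' S) y x y')
    {x x' : α} {y : Fin n} : ¬ IsPivot J (pathGraph n) S x y x' := by
  intro h
  induction hd : n - y.val using Nat.strong_induction_on generalizing x x' y with
  | _ d ih =>
    obtain ⟨a, b, hab, ha, hb⟩ := h.exists_two
    rw [pathGraph_adj] at ha hb
    rw [ne_eq, Fin.ext_iff] at hab
    have hlt : y.val + 1 < n := by omega
    obtain ⟨y₂, hy₂, hne, h₂⟩ := h.exists_next hK hall (y₁ := ⟨y.val + 1, hlt⟩)
      (pathGraph_adj.mpr (Or.inl rfl))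
    rw [pathGraph_adj] at hy₂
    rw [ne_eq, Fin.ext_iff] at hne
    simp only at hy₂
    exact ih (n - y₂.val) (by omega) h₂ rfl

theorem IsPivot.add_two_cycleGraph (hn : 3 ≤ n) {S : Set (α × Fin n)}
    (hK : MaxDegreeLeTwo (cycleGraph n))
    (hall : ∀ x y, (x, y) ∈ S → (∃ x', IsPivot J (cycleGraph n) S x y x') ∨
      ∃ y', IsPivot (cycleGraph n) J (Prod.swap ⁻¹' S) y x y')
    {x x' : α} {y z : Fin n} (h : IsPivot J (cycleGraph n) S x y x')
    (hz : z.val = (y.val + 2) % n) : IsPivot J (cycleGraph n) S x' z x := by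
  have hy := y.isLt
  have hmod : ∀ i, i < n + n → i % n = if i < n then i else i - n := by
    intro i hi
    split_ifs with h
    · exact Nat.mod_eq_of_lt h
    · rw [Nat.mod_eq_sub_mod (by omega), Nat.mod_eq_of_lt (by omega)]
  have h1 := hmod (y.val + 1) (by omega)
  have h2 := hmod (y.val + 2) (by omega)
  obtain ⟨y₂, hy₂, hne, hp⟩ := h.exists_next hK hall
    (y₁ := ⟨(y.val + 1) % n, Nat.mod_lt _ (by omega)⟩) (by
      rw [cycleGraph_adj_iff_val hn]
      simp only
      split_ifs at h1 <;> omega)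
  have : z = y₂ := by
    rw [cycleGraph_adj_iff_val hn] at hy₂
    rw [ne_eq, Fin.ext_iff] at hne
    rw [Fin.ext_iff]
    have := y₂.isLt
    simp only at hy₂
    split_ifs at h1 h2 <;> omega
  exact this ▸ hp

/-- On a cycle the chain of pivots moves by two vertices while it changes sides, so it closes up
consistently only if the length is a multiple of four. -/
theorem four_dvd_of_isPivot {K : SimpleGraph (Fin n)} (hK : IsPathOrCycle n K)
    {S : Set (α × Fin n)}
    (hall : ∀ x y, (x, y) ∈ S → (∃ x', IsPivot J K S x y x') ∨
      ∃ y', IsPivot K J (Prod.swap ⁻¹' S) y x y')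
    {x x' : α} {y : Fin n} (h : IsPivot J K S x y x') : (3 ≤ n ∧ K = cycleGraph n) ∧ 4 ∣ n := by
  have hK2 := hK.maxDegreeLeTwo
  rcases hK with rfl | ⟨hn, rfl⟩
  · exact absurd h (not_isPivot_pathGraph hK2 hall)
  refine ⟨⟨hn, rfl⟩, ?_⟩
  by_contra h4
  have hpos : 0 < n := by omega
  have hiter : ∀ k : ℕ, IsPivot J (cycleGraph n) S x ⟨(y.val + 4 * k) % n, Nat.mod_lt _ hpos⟩
      x' := by
    intro k
    induction k with
    | zero =>
      have : (⟨(y.val + 4 * 0) % n, Nat.mod_lt _ hpos⟩ : Fin n) = y :=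
        Fin.ext (Nat.mod_eq_of_lt (by simp))
      rw [this]
      exact h
    | succ k ih =>
      refine (ih.add_two_cycleGraph hn hK2 hall
        (z := ⟨(y.val + 4 * k + 2) % n, Nat.mod_lt _ hpos⟩) ?_).add_two_cycleGraph hn hK2 hall ?_
      · simp
      · simp only [Nat.mod_add_mod]
        congr 1
  -- Since `4` does not divide `n`, the steps of length `4` reach the step of length `2`.
  obtain ⟨k, j, hk⟩ : ∃ k j, 4 * k = 2 + n * j := by
    rcases Nat.even_or_odd' n with ⟨c, hc | hc⟩
    · rcases Nat.even_or_odd' c with ⟨d, hd | hd⟩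
      · exact absurd ⟨d, by omega⟩ h4
      · exact ⟨d + 1, 1, by omega⟩
    · exact ⟨c + 1, 2, by omega⟩
  have h1 := hiter k
  have h2 := h.add_two_cycleGraph hn hK2 hall
    (z := ⟨(y.val + 4 * k) % n, Nat.mod_lt _ hpos⟩) (by
      simp only [hk]
      rw [← add_assoc, Nat.add_mul_mod_self_left])
  exact h1.notMem h2.mem

end Rigidity

/-- The lower bound behind the equality: a power dominating set `S` with propagation time `t ≥ 2`
satisfies `nm ≤ 4t|S|`, and equality requires a cycle whose length is a multiple of four. -/
theorem card_le_of_observedSet_eq_univ {n m : ℕ} {J : SimpleGraph (Fin n)}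
    {K : SimpleGraph (Fin m)} (hJ : IsPathOrCycle n J) (hK : IsPathOrCycle m K)
    (S : Finset (Fin n × Fin m)) (hS : S.Nonempty) {t : ℕ} (ht : 2 ≤ t)
    (hobs : observedSet (J □ K) (S : Set (Fin n × Fin m)) t = Set.univ) :
    n * m < 4 * (S.card * t) ∨ (n * m = 4 * (S.card * t) ∧
      (((3 ≤ n ∧ J = cycleGraph n) ∧ 4 ∣ n) ∨ ((3 ≤ m ∧ K = cycleGraph m) ∧ 4 ∣ m))) := by
  obtain ⟨i, rfl⟩ := Nat.exists_eq_add_of_le ht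
  have hJ2 := hJ.maxDegreeLeTwo
  have hK2 := hK.maxDegreeLeTwo
  obtain ⟨h1, h2⟩ := ncard_observedSet_two_le hJ2 hK2 S
  have h3 := ncard_observedSet_add_le (J □ K) (S : Set (Fin n × Fin m)) 1 i
  have h4 : (activeSet (J □ K) (closedNbhd (J □ K) (S : Set (Fin n × Fin m)))).ncard
      ≤ S.card * 4 :=
    (Set.ncard_le_ncard (activeSet_closedNbhd_subset _ _) (Set.toFinite _)).trans
      (ncard_closedNbhd_sdiff_le _ S 4 fun s _ => ncard_neighborSet_boxProd_le
        (hJ2.ncard_neighborSet_le s.1) (hK2.ncard_neighborSet_le s.2))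
  rw [show 1 + 1 = 2 from rfl, hobs, Set.ncard_univ, Nat.card_prod, Nat.card_fin,
    Nat.card_fin] at h3
  have h5 : i * (activeSet (J □ K) (closedNbhd (J □ K) (S : Set (Fin n × Fin m)))).ncard
      ≤ i * (S.card * 4) := Nat.mul_le_mul_left i h4
  have h6 : 4 * (S.card * (2 + i)) = 8 * S.card + i * (S.card * 4) := by ring
  rcases lt_or_eq_of_le (show n * m ≤ 4 * (S.card * (2 + i)) by omega) with hlt | heq
  · exact Or.inl hlt
  · refine Or.inr ⟨heq, ?_⟩
    have hall := h2 (by omega)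
    obtain ⟨⟨x, y⟩, hxy⟩ := hS
    rcases hall x y hxy with ⟨x', h⟩ | ⟨y', h⟩
    · exact Or.inr (four_dvd_of_isPivot hK hall h)
    · refine Or.inl (four_dvd_of_isPivot hJ (fun a b hab => ?_) h)
      exact (hall b a hab).symm

/-! ### Dominating sets of grids -/

/-- The cells `p` and `q` of the integer grid are equal or adjacent. -/
def CellNear (p q : ℕ × ℕ) : Prop :=
  (p.1 = q.1 ∧ (p.2 = q.2 ∨ p.2 + 1 = q.2 ∨ q.2 + 1 = p.2)) ∨
    (p.2 = q.2 ∧ (p.1 + 1 = q.1 ∨ q.1 + 1 = p.1))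

instance : DecidableRel CellNear := fun _ _ => inferInstanceAs (Decidable (_ ∨ _))

/-- The grid `P_n □ P_m`, with vertex set `[0, n) × [0, m)`, has a dominating set of at most `k`
vertices. -/
def GridDominated (n m k : ℕ) : Prop :=
  ∃ D : Finset (ℕ × ℕ), D.card ≤ k ∧
    ∀ i < n, ∀ j < m, ∃ p ∈ D, p.1 < n ∧ p.2 < m ∧ CellNear p (i, j)

theorem GridDominated.mono {n m k l : ℕ} (h : GridDominated n m k) (hkl : k ≤ l) :
    GridDominated n m l := by
  obtain ⟨D, hD, h⟩ := h
  exact ⟨D, hD.trans hkl, h⟩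

theorem GridDominated.symm {n m k : ℕ} (h : GridDominated n m k) : GridDominated m n k := by
  obtain ⟨D, hD, h⟩ := h
  refine ⟨D.image Prod.swap, Finset.card_image_le.trans hD, fun i hi j hj => ?_⟩
  obtain ⟨p, hp, h1, h2, h3⟩ := h j hj i hi
  refine ⟨p.swap, Finset.mem_image_of_mem _ hp, h2, h1, ?_⟩
  simp only [CellNear, Prod.fst_swap, Prod.snd_swap] at h3 ⊢
  omega

theorem GridDominated.add {n a b k l : ℕ} (h : GridDominated n a k) (h' : GridDominated n b l) :
    GridDominated n (a + b) (k + l) := by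
  obtain ⟨D, hD, h⟩ := h
  obtain ⟨D', hD', h'⟩ := h'
  refine ⟨D ∪ D'.image (fun p => (p.1, p.2 + a)), (Finset.card_union_le _ _).trans
    (add_le_add hD (Finset.card_image_le.trans hD')), fun i hi j hj => ?_⟩
  rcases lt_or_ge j a with hja | hja
  · obtain ⟨p, hp, h1, h2, h3⟩ := h i hi j hja
    exact ⟨p, Finset.mem_union_left _ hp, h1, by omega, h3⟩
  · obtain ⟨p, hp, h1, h2, h3⟩ := h' i hi (j - a) (by omega)
    refine ⟨(p.1, p.2 + a), Finset.mem_union_right _ (Finset.mem_image_of_mem _ hp), h1,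
      by simp only; omega, ?_⟩
    simp only [CellNear] at h3 ⊢
    omega

/-- Every third vertex of a path dominates it. -/
theorem gridDominated_one (m : ℕ) : GridDominated 1 m ((m + 2) / 3) := by
  refine ⟨(Finset.range ((m + 2) / 3)).image (fun k => (0, min (3 * k + 1) (m - 1))),
    Finset.card_image_le.trans (by simp), fun i hi j hj => ?_⟩
  refine ⟨_, Finset.mem_image_of_mem _ (Finset.mem_range.mpr (?_ : j / 3 < _)), ?_, ?_, ?_⟩
  · omega
  · simp
  · simp only; omega
  · simp only [CellNear]; omega

/-- In a strip of width two, every second column holds a vertex, on alternate sides. -/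
theorem gridDominated_two {m : ℕ} (hm : 1 ≤ m) : GridDominated 2 m (2 * m / 4 + 1) := by
  refine ⟨(Finset.range (m / 2 + 1)).image (fun k => (k % 2, min (2 * k) (m - 1))),
    Finset.card_image_le.trans (by rw [Finset.card_range]; omega), fun i hi j hj => ?_⟩
  have key : ∀ k < m / 2 + 1, CellNear (k % 2, min (2 * k) (m - 1)) (i, j) →
      ∃ p ∈ (Finset.range (m / 2 + 1)).image (fun k => (k % 2, min (2 * k) (m - 1))),
        p.1 < 2 ∧ p.2 < m ∧ CellNear p (i, j) := by
    intro k hk h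
    exact ⟨_, Finset.mem_image_of_mem _ (Finset.mem_range.mpr hk), by simp only; omega,
      by simp only; omega, h⟩
  by_cases hi' : i = (j / 2) % 2 ∨ j % 2 = 0
  · exact key (j / 2) (by omega) (by simp only [CellNear]; omega)
  · exact key (j / 2 + 1) (by omega) (by simp only [CellNear]; omega)

/-- In a strip of width three, every second column holds the middle vertex or the two outer
vertices, alternately. -/
theorem gridDominated_three {m : ℕ} (hm : 1 ≤ m) : GridDominated 3 m (3 * m / 4 + 1) := by
  set f : ℕ → ℕ × ℕ := fun k =>
    if k % 3 = 0 then (1, min (4 * (k / 3)) (m - 1))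
    else if 4 * (k / 3) + 2 < m then (2 * (k % 3) - 2, 4 * (k / 3) + 2) else (1, m - 1) with hf
  refine ⟨(Finset.range (3 * m / 4 + 1)).image f,
    Finset.card_image_le.trans (by rw [Finset.card_range]), fun i hi j hj => ?_⟩
  have key : ∀ k < 3 * m / 4 + 1, CellNear (f k) (i, j) →
      ∃ p ∈ (Finset.range (3 * m / 4 + 1)).image f, p.1 < 3 ∧ p.2 < m ∧ CellNear p (i, j) := by
    intro k hk h
    refine ⟨_, Finset.mem_image_of_mem _ (Finset.mem_range.mpr hk), ?_, ?_, h⟩ <;>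
    · simp only [hf]
      split_ifs <;> simp only <;> omega
  have h0 : ∀ q, f (3 * q) = (1, min (4 * q) (m - 1)) := by
    intro q
    simp only [hf]
    rw [if_pos (by omega), show 3 * q / 3 = q by omega]
  have h1 : ∀ q, f (3 * q + 1) = if 4 * q + 2 < m then (0, 4 * q + 2) else (1, m - 1) := by
    intro q
    simp only [hf]
    rw [if_neg (by omega), show (3 * q + 1) / 3 = q by omega, show (3 * q + 1) % 3 = 1 by omega]
  have h2 : ∀ q, 4 * q + 2 < m → f (3 * q + 2) = (2, 4 * q + 2) := by
    intro q hq
    simp only [hf]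
    rw [if_neg (by omega), show (3 * q + 2) / 3 = q by omega, show (3 * q + 2) % 3 = 2 by omega,
      if_pos hq]
  obtain ⟨q, r, hr, rfl⟩ : ∃ q r, r < 4 ∧ j = 4 * q + r := ⟨j / 4, j % 4, by omega, by omega⟩
  by_cases hc : r = 0 ∨ (r = 1 ∧ i = 1)
  · exact key (3 * q) (by omega) (by rw [h0]; simp only [CellNear]; omega)
  by_cases hc' : r = 3 ∧ i = 1
  · exact key (3 * (q + 1)) (by omega) (by rw [h0]; simp only [CellNear]; omega)
  by_cases hi2 : i = 2 ∧ 4 * q + 2 < m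
  · exact key (3 * q + 2) (by omega) (by rw [h2 q hi2.2]; simp only [CellNear]; omega)
  · refine key (3 * q + 1) (by omega) ?_
    rw [h1]
    split_ifs <;> simp only [CellNear] <;> omega

theorem gridDominated_four_four : GridDominated 4 4 4 :=
  ⟨{(1, 0), (3, 1), (0, 2), (2, 3)}, by decide, by decide +kernel⟩

theorem gridDominated_four_seven : GridDominated 4 7 7 :=
  ⟨{(2, 0), (0, 1), (3, 2), (1, 3), (3, 4), (0, 5), (2, 6)}, by decide, by decide +kernel⟩

theorem gridDominated_four_ten : GridDominated 4 10 10 :=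
  ⟨{(1, 0), (3, 1), (0, 2), (2, 3), (0, 4), (3, 5), (1, 6), (3, 7), (0, 8), (2, 9)},
    by decide, by decide +kernel⟩

theorem gridDominated_four_thirteen : GridDominated 4 13 13 :=
  ⟨{(2, 0), (0, 1), (3, 2), (1, 3), (3, 4), (0, 5), (2, 6), (0, 7), (3, 8), (1, 9), (3, 10),
    (0, 11), (2, 12)}, by decide, by decide +kernel⟩

theorem gridDominated_five_seven : GridDominated 5 7 9 :=
  ⟨{(1, 0), (3, 1), (4, 1), (0, 2), (2, 3), (4, 4), (0, 5), (1, 5), (3, 6)},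
    by decide, by decide +kernel⟩

theorem gridDominated_five_eleven : GridDominated 5 11 14 :=
  ⟨{(2, 0), (0, 1), (4, 1), (3, 2), (1, 3), (4, 4), (0, 5), (2, 5), (4, 6), (1, 7), (3, 8),
    (0, 9), (2, 10), (4, 10)}, by decide, by decide +kernel⟩

theorem gridDominated_five_fifteen : GridDominated 5 15 19 :=
  ⟨{(2, 0), (0, 1), (4, 1), (3, 2), (1, 3), (4, 4), (0, 5), (2, 5), (4, 6), (1, 7), (3, 8),
    (0, 9), (2, 10), (4, 10), (1, 11), (3, 12), (0, 13), (2, 14), (4, 14)},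
    by decide, by decide +kernel⟩

theorem gridDominated_five_sixteen : GridDominated 5 16 20 :=
  ⟨{(2, 0), (0, 1), (4, 1), (1, 2), (3, 3), (0, 4), (2, 5), (4, 5), (0, 6), (3, 7), (1, 8),
    (4, 9), (0, 10), (2, 10), (4, 11), (1, 12), (3, 13), (0, 14), (2, 15), (4, 15)},
    by decide, by decide +kernel⟩

/-- A strip of width four and any other length can be glued from strips of lengths `4`, `7`, `10`
and `13` that need one vertex per column. -/
theorem gridDominated_four {n : ℕ} (hn : 4 ≤ n) (h5 : n ≠ 5) (h6 : n ≠ 6) (h9 : n ≠ 9) :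
    GridDominated 4 n n := by
  induction n using Nat.strong_induction_on with
  | _ n ih =>
    by_cases hc : n = 4 ∨ n = 7 ∨ n = 10 ∨ n = 13
    · rcases hc with rfl | rfl | rfl | rfl
      exacts [gridDominated_four_four, gridDominated_four_seven, gridDominated_four_ten,
        gridDominated_four_thirteen]
    · have h := (ih (n - 4) (by omega) (by omega) (by omega) (by omega) (by omega)).add
        gridDominated_four_four
      rwa [Nat.sub_add_cancel hn] at h

theorem gridDominated_five {m : ℕ} (hm : 2 ≤ m) : GridDominated 5 m (5 * m / 4 + 1) := by
  induction m using Nat.strong_induction_on with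
  | _ m ih =>
    have h3 : GridDominated 5 3 4 := (gridDominated_three (m := 5) (by omega)).symm
    by_cases h18 : 18 ≤ m
    · have h := (ih (m - 16) (by omega) (by omega)).add gridDominated_five_sixteen
      rw [Nat.sub_add_cancel (by omega)] at h
      exact h.mono (by omega)
    by_cases hc : m = 2 ∨ m = 3 ∨ m = 4 ∨ m = 7 ∨ m = 11 ∨ m = 15 ∨ m = 16
    · rcases hc with rfl | rfl | rfl | rfl | rfl | rfl | rfl
      · exact (gridDominated_two (m := 5) (by omega)).symm
      · exact h3
      · exact ((gridDominated_two (m := 5) (by omega)).symm.add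
          (gridDominated_two (m := 5) (by omega)).symm).mono (by omega)
      exacts [gridDominated_five_seven, gridDominated_five_eleven, gridDominated_five_fifteen,
        gridDominated_five_sixteen.mono (by omega)]
    · have h := (ih (m - 3) (by omega) (by omega)).add h3
      rw [Nat.sub_add_cancel (by omega)] at h
      exact h.mono (by omega)

/-- The domination number of a grid is at most `⌊nm / 4⌋ + 1`. Four columns more raise this bound
by `n`, which is what a strip of width four costs; the lengths `5`, `6` and `9`, at which that
strip costs more, are glued from strips of width three, or are covered by the strips of width
five. -/
theorem gridDominated {n m : ℕ} (hn : 2 ≤ n) (hm : 2 ≤ m) :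
    GridDominated n m (n * m / 4 + 1) := by
  induction hs : n + m using Nat.strong_induction_on generalizing n m with
  | _ s ih =>
    by_cases h2 : n = 2 ∨ n = 3 ∨ n = 5
    · rcases h2 with rfl | rfl | rfl
      exacts [gridDominated_two (by omega), gridDominated_three (by omega),
        gridDominated_five hm]
    by_cases h2' : m = 2 ∨ m = 3 ∨ m = 5
    · rw [mul_comm]
      rcases h2' with rfl | rfl | rfl
      exacts [(gridDominated_two (by omega)).symm, (gridDominated_three (by omega)).symm,
        (gridDominated_five hn).symm]
    by_cases hn4 : n = 4 ∧ m = 4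
    · obtain ⟨rfl, rfl⟩ := hn4
      exact gridDominated_four_four.mono (by omega)
    by_cases h4 : 6 ≤ m ∧ n ≠ 6 ∧ n ≠ 9
    · have h := (ih (n + (m - 4)) (by omega) hn (by omega) rfl).add
        (gridDominated_four (n := n) (by omega) (by omega) h4.2.1 h4.2.2).symm
      rw [Nat.sub_add_cancel (by omega)] at h
      refine h.mono ?_
      obtain ⟨l, rfl⟩ := Nat.exists_eq_add_of_le' (show 4 ≤ m by omega)
      rw [Nat.add_sub_cancel, mul_add]
      omega
    by_cases h4' : 6 ≤ n ∧ m ≠ 6 ∧ m ≠ 9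
    · have h := (ih (m + (n - 4)) (by omega) hm (by omega) rfl).add
        (gridDominated_four (n := m) (by omega) (by omega) h4'.2.1 h4'.2.2).symm
      rw [Nat.sub_add_cancel (by omega)] at h
      refine h.symm.mono ?_
      obtain ⟨l, rfl⟩ := Nat.exists_eq_add_of_le' (show 4 ≤ n by omega)
      rw [Nat.add_sub_cancel, add_mul, mul_comm m l]
      omega
    have h6 := (gridDominated_three (m := 6) (by omega)).symm
    have h9 := (gridDominated_three (m := 9) (by omega)).symm
    have hn' : n = 6 ∨ n = 9 := by omega
    have hm' : m = 6 ∨ m = 9 := by omega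
    rcases hn' with rfl | rfl <;> rcases hm' with rfl | rfl
    · exact h6.add h6
    · exact (h9.add h9).symm
    · exact h9.add h9
    · exact ((h9.add h9).add h9).mono (by omega)

/-! ### Product power throttling of grids, cylinders and tori -/

theorem dominationNumber_le {V : Type*} [Fintype V] {G : SimpleGraph V} (D : Finset V)
    (h : ∀ v, v ∈ D ∨ ∃ u ∈ D, G.Adj u v) : dominationNumber G ≤ D.card :=
  Nat.sInf_le ⟨D, Set.eq_univ_of_forall fun v => h v, rfl⟩

theorem IsPathOrCycle.pathGraph_le {n : ℕ} {J : SimpleGraph (Fin n)} (h : IsPathOrCycle n J) :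
    pathGraph n ≤ J := by
  rcases h with rfl | ⟨-, rfl⟩
  exacts [le_rfl, pathGraph_le_cycleGraph]

theorem GridDominated.dominationNumber_le {n m k : ℕ} (h : GridDominated n m k)
    {J : SimpleGraph (Fin n)} {K : SimpleGraph (Fin m)} (hJ : pathGraph n ≤ J)
    (hK : pathGraph m ≤ K) : dominationNumber (J □ K) ≤ k := by
  obtain ⟨D, hD, h⟩ := h
  refine le_trans (_root_.dominationNumber_le
    (Finset.univ.filter fun v : Fin n × Fin m => (v.1.val, v.2.val) ∈ D) ?_)
    (le_trans ?_ hD)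
  · rintro ⟨i, j⟩
    obtain ⟨⟨p, q⟩, hp, h1, h2, h3⟩ := h i i.isLt j j.isLt
    have hmem : ((⟨p, h1⟩, ⟨q, h2⟩) : Fin n × Fin m) ∈
        Finset.univ.filter fun v : Fin n × Fin m => (v.1.val, v.2.val) ∈ D := by simpa using hp
    rcases h3 with ⟨h4, h5 | h5⟩ | ⟨h4, h5⟩
    · refine Or.inl ?_
      simpa [← show p = i.val from h4, ← show q = j.val from h5] using hp
    · refine Or.inr ⟨_, hmem, boxProd_adj.mpr (Or.inr ⟨hK ?_, Fin.ext h4⟩)⟩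
      exact pathGraph_adj.mpr h5
    · refine Or.inr ⟨_, hmem, boxProd_adj.mpr (Or.inl ⟨hJ ?_, Fin.ext h4⟩)⟩
      exact pathGraph_adj.mpr h5
  · refine Finset.card_le_card_of_injOn (fun v => (v.1.val, v.2.val))
      (fun v hv => by simpa using hv) ?_
    rintro ⟨a, b⟩ - ⟨c, d⟩ - heq
    simpa [Fin.ext_iff] using heq

/-- On a cycle of length `4a` times a path, a quarter of the vertices dominate: every column takes
one residue class modulo four, with the classes `0` and `2` alternating. -/
theorem dominationNumber_le_of_cycleGraph {n m : ℕ} (hn : 3 ≤ n) (h4 : 4 ∣ n) (hm : 2 ≤ m)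
    {K : SimpleGraph (Fin m)} (hK : pathGraph m ≤ K) :
    4 * dominationNumber (cycleGraph n □ K) ≤ n * m := by
  classical
  obtain ⟨a, rfl⟩ := h4
  set f : Fin a × Fin m → Fin (4 * a) × Fin m := fun v =>
    (⟨4 * v.1.val + 2 * (v.2.val % 2), by omega⟩, v.2) with hf
  have hmem : ∀ (i : Fin (4 * a)) (j : Fin m), i.val % 4 = 2 * (j.val % 2) →
      (i, j) ∈ Finset.univ.image f := by
    intro i j h
    refine Finset.mem_image.mpr ⟨(⟨i.val / 4, by omega⟩, j), Finset.mem_univ _, ?_⟩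
    simp only [hf, Prod.mk.injEq, and_true]
    exact Fin.ext (by simp only; omega)
  have hle := dominationNumber_le (G := cycleGraph (4 * a) □ K) (Finset.univ.image f) ?_
  · have hc := (Finset.card_image_le (s := Finset.univ) (f := f))
    rw [Finset.card_univ, Fintype.card_prod, Fintype.card_fin, Fintype.card_fin] at hc
    calc 4 * dominationNumber (cycleGraph (4 * a) □ K) ≤ 4 * (a * m) := by omega
      _ = 4 * a * m := by ring
  · rintro ⟨i, j⟩
    have hi := i.isLt
    have hj := j.isLt
    by_cases h0 : i.val % 4 = 2 * (j.val % 2)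
    · exact Or.inl (hmem i j h0)
    right
    by_cases h2 : i.val % 2 = 0
    · -- The neighboring columns carry the opposite residue class.
      obtain ⟨j', hj'⟩ : ∃ j' : Fin m, j'.val + 1 = j.val ∨ j.val + 1 = j'.val := by
        by_cases hj0 : j.val = 0
        · exact ⟨⟨1, by omega⟩, Or.inr (by simp only; omega)⟩
        · exact ⟨⟨j.val - 1, by omega⟩, Or.inl (by simp only; omega)⟩
      exact ⟨(i, j'), hmem i j' (by omega),
        boxProd_adj.mpr (Or.inr ⟨hK (pathGraph_adj.mpr hj'), rfl⟩)⟩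
    · obtain ⟨i', hi', hadj⟩ : ∃ i' : Fin (4 * a), i'.val % 4 = 2 * (j.val % 2) ∧
          (cycleGraph (4 * a)).Adj i' i := by
        by_cases h1 : i.val % 4 = 2 * (j.val % 2) + 1
        · refine ⟨⟨i.val - 1, by omega⟩, by simp only; omega, ?_⟩
          rw [cycleGraph_adj_iff_val hn]
          simp only
          omega
        · by_cases hlast : i.val + 1 = 4 * a
          · refine ⟨⟨0, by omega⟩, by simp only; omega, ?_⟩
            exact (cycleGraph_adj_iff_val hn _ _).mpr (Or.inr (Or.inr (Or.inl ⟨rfl, hlast⟩)))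
          · refine ⟨⟨i.val + 1, by omega⟩, by simp only; omega, ?_⟩
            exact (cycleGraph_adj_iff_val hn _ _).mpr (Or.inr (Or.inl rfl))
      exact ⟨(i', j), hmem i' j hi', boxProd_adj.mpr (Or.inl ⟨hadj, rfl⟩)⟩

theorem dominationNumber_boxProd_le_swap {α β : Type*} [Fintype α] [Fintype β] (J : SimpleGraph α)
    (K : SimpleGraph β) : dominationNumber (J □ K) ≤ dominationNumber (K □ J) := by
  obtain ⟨D, hD, hc⟩ := Nat.sInf_mem (s := {k : ℕ | ∃ S : Finset (β × α),
    IsDominatingSet (K □ J) (S : Set (β × α)) ∧ S.card = k})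
    ⟨_, Finset.univ, by simp [IsDominatingSet, closedNbhd], rfl⟩
  have hle := dominationNumber_le (G := J □ K) (D.map (Equiv.prodComm β α).toEmbedding) ?_
  · rw [Finset.card_map, hc] at hle
    exact hle
  · rintro ⟨a, b⟩
    have hv : (b, a) ∈ closedNbhd (K □ J) (D : Set (β × α)) := hD ▸ Set.mem_univ _
    rcases hv with h | ⟨⟨p, q⟩, h, hadj⟩
    · exact Or.inl (by simpa using h)
    · exact Or.inr ⟨(q, p), by simpa using h, by simpa [boxProd_adj, or_comm] using hadj⟩

/-- The domination number is an upper bound, attained with propagation time one; it is the product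
power throttling number as soon as slower propagation does not beat it. -/
theorem productPowerThrottling_eq_dominationNumber {V : Type*} [Fintype V] [Nonempty V]
    {G : SimpleGraph V}
    (h : ∀ S : Finset V, S.Nonempty → ∀ t, 2 ≤ t → observedSet G (S : Set V) t = Set.univ →
      dominationNumber G ≤ S.card * t) :
    productPowerThrottling G = (dominationNumber G : ℕ∞) := by
  apply le_antisymm
  · obtain ⟨D, hD, hc⟩ := Nat.sInf_mem (s := {k : ℕ | ∃ S : Finset V,
      IsDominatingSet G (S : Set V) ∧ S.card = k})
      ⟨_, Finset.univ, by simp [IsDominatingSet, closedNbhd], rfl⟩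
    have hne : D.Nonempty := by
      rw [Finset.nonempty_iff_ne_empty]
      rintro rfl
      obtain ⟨v⟩ := ‹Nonempty V›
      have hv : v ∈ closedNbhd G ((∅ : Finset V) : Set V) := hD ▸ Set.mem_univ _
      simp [closedNbhd] at hv
    have hpt : powerPropagationTime G (D : Set V) ≤ ((1 : ℕ) : ℕ∞) :=
      iInf₂_le (f := fun (t : ℕ) (_ : 1 ≤ t ∧ observedSet G (D : Set V) t = Set.univ) =>
        (t : ℕ∞)) 1 ⟨le_rfl, hD⟩
    calc productPowerThrottling G ≤ (D.card : ℕ∞) * powerPropagationTime G (D : Set V) :=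
          iInf₂_le (f := fun (S : Finset V) (_ : S.Nonempty) =>
            (S.card : ℕ∞) * powerPropagationTime G (S : Set V)) D hne
      _ ≤ (D.card : ℕ∞) * ((1 : ℕ) : ℕ∞) := by gcongr
      _ = (dominationNumber G : ℕ∞) := by
          rw [Nat.cast_one, mul_one, hc]
          rfl
  · refine le_iInf₂ fun S hS => ?_
    by_cases hex : ∃ t, 1 ≤ t ∧ observedSet G (S : Set V) t = Set.univ
    · classical
      have hpt : ((Nat.find hex : ℕ) : ℕ∞) ≤ powerPropagationTime G (S : Set V) :=
        le_iInf₂ fun t ht => by exact_mod_cast Nat.find_min' hex ht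
      obtain ⟨h1, hu⟩ := Nat.find_spec hex
      refine le_trans ?_ (mul_le_mul_right hpt _)
      norm_cast
      rcases Nat.eq_or_lt_of_le h1 with h1 | h2
      · rw [← h1] at hu ⊢
        rw [mul_one]
        exact Nat.sInf_le ⟨S, hu, rfl⟩
      · exact h S hS _ h2 hu
    · have htop : powerPropagationTime G (S : Set V) = ⊤ := by
        refine iInf₂_eq_top.mpr fun t ht => absurd ⟨t, ht⟩ hex
      rw [htop, ENat.mul_top (by simpa using hS.ne_empty)]
      exact le_top

/-- In a graph of maximum degree two, `t` rounds observe at most `(2t + 1)|S|` vertices. -/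
theorem card_le_of_ncard_neighborSet_le_two {V : Type*} [Fintype V] {G : SimpleGraph V}
    (hdeg : ∀ v, (G.neighborSet v).ncard ≤ 2) (S : Finset V) {t : ℕ} (ht : 1 ≤ t)
    (hobs : observedSet G (S : Set V) t = Set.univ) : Fintype.card V ≤ 3 * (S.card * t) := by
  obtain ⟨i, rfl⟩ := Nat.exists_eq_add_of_le ht
  have h1 := ncard_observedSet_add_le G (S : Set V) 0 i
  have h2 := ncard_closedNbhd_sdiff_le G S 2 fun s _ => hdeg s
  have h3 := (Set.ncard_le_ncard (activeSet_closedNbhd_subset G (S : Set V))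
    (Set.toFinite _)).trans h2
  have h4 := ncard_closedNbhd G (S : Set V)
  rw [Set.ncard_coe_finset] at h4
  rw [show 0 + 1 = 1 from rfl, hobs, Set.ncard_univ, Nat.card_eq_fintype_card,
    show observedSet G (S : Set V) 1 = closedNbhd G S from rfl] at h1
  have h5 := Nat.mul_le_mul_left i h3
  nlinarith

theorem ncard_neighborSet_fin_one (J : SimpleGraph (Fin 1)) (v : Fin 1) :
    (J.neighborSet v).ncard ≤ 0 := by
  rw [Nat.le_zero, Set.ncard_eq_zero]
  ext w
  simp [Subsingleton.elim w v]

theorem mainTheorem4 (n m : ℕ) (hn : 1 ≤ n) (hm : 1 ≤ m)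
    (Jn : SimpleGraph (Fin n)) (Jm : SimpleGraph (Fin m))
    (hJn : IsPathOrCycle n Jn) (hJm : IsPathOrCycle m Jm) :
    productPowerThrottling (Jn □ Jm) = (dominationNumber (Jn □ Jm) : ℕ∞) := by
  have : Nonempty (Fin n) := ⟨⟨0, hn⟩⟩
  have : Nonempty (Fin m) := ⟨⟨0, hm⟩⟩
  apply productPowerThrottling_eq_dominationNumber
  intro S hS t ht hobs
  rcases Nat.eq_or_lt_of_le hn with rfl | hn2
  · have hγ := (gridDominated_one m).dominationNumber_le hJn.pathGraph_le hJm.pathGraph_le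
    have := card_le_of_ncard_neighborSet_le_two (fun v => ncard_neighborSet_boxProd_le
      (ncard_neighborSet_fin_one Jn v.1) (hJm.maxDegreeLeTwo.ncard_neighborSet_le v.2)) S
      (by omega) hobs
    rw [Fintype.card_prod, Fintype.card_fin, Fintype.card_fin] at this
    omega
  rcases Nat.eq_or_lt_of_le hm with rfl | hm2
  · have hγ := (gridDominated_one n).symm.dominationNumber_le hJn.pathGraph_le hJm.pathGraph_le
    have := card_le_of_ncard_neighborSet_le_two (fun v => ncard_neighborSet_boxProd_le
      (hJn.maxDegreeLeTwo.ncard_neighborSet_le v.1) (ncard_neighborSet_fin_one Jm v.2)) S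
      (by omega) hobs
    rw [Fintype.card_prod, Fintype.card_fin, Fintype.card_fin] at this
    omega
  rcases card_le_of_observedSet_eq_univ hJn hJm S hS ht hobs with
    hlt | ⟨heq, ⟨⟨hn3, rfl⟩, h4⟩ | ⟨⟨hm3, rfl⟩, h4⟩⟩
  · have := (gridDominated hn2 hm2).dominationNumber_le hJn.pathGraph_le hJm.pathGraph_le
    omega
  · have := dominationNumber_le_of_cycleGraph hn3 h4 hm2 hJm.pathGraph_le
    omega
  · have := dominationNumber_le_of_cycleGraph hm3 h4 hn2 hJn.pathGraph_le
    have hcomm := dominationNumber_boxProd_le_swap Jn (cycleGraph m)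
    rw [mul_comm m n] at this
    omega
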